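/- Let $\mathbf{k}$ be an algebraically closed field of arbitrary characteristic; let $x,y,z$ be the coordinates of $\mathbb{A}^3=\mathbb{A}^3_{\mathbf{k}}$, and write a morphism $f\colon\mathbb{A}^d\to\mathbb{A}^n$ as the tuple $(f_1,\dots,f_n)$ of its component polynomials. An automorphism of $\mathbb{A}^n$ is affine if all its components have degree $1$, and triangular if its $i$-th component lies in $\mathbf{k}[x_i,\dots,x_n]$ for each $i$. Two morphisms $f,g\colon\mathbb{A}^d\to\mathbb{A}^n$ are equivalent if $f=\alpha\circ g\circ\beta$ for affine automorphisms $\alpha$ of $\mathbb{A}^n$ and $\beta$ of $\mathbb{A}^d$. A morphism $f\colon\mathbb{A}^d\to\mathbb{A}^n$ is an affine linear system of affine spaces if for all $\lambda_0\in\mathbf{k}$ and $(\lambda_1,\dots,\lambda_n)\in\mathbf{k}^n\setminus\{0\}$ the polynomial $\lambda_0+\sum_i\lambda_if_i$ is not constant and the hypersurface of $\mathbb{A}^d$ that it defines is isomorphic to $\mathbb{A}^{d-1}$. The zero polynomial is regarded as homogeneous of every degree. Consider the following eleven families of morphisms $\mathbb{A}^3\to\mathbb{A}^n$ ($n=1$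 for (1)–(3), $n=2$ for (4)–(9), $n=3$ for (10)–(11)). 1. $x+r_2(y,z)+r_3(y,z)$, where $r_i\in\mathbf{k}[y,z]$ is homogeneous of degree $i$; 2. $xy+y\,r_2(y,z)+z$, where $r_2\in\mathbf{k}[y,z]\setminus\mathbf{k}[y]$ is homogeneous of degree $2$; 3. $xy^2+y(z^2+az+b)+z$, where $a,b\in\mathbf{k}$; 4. $(x+p_2(y,z)+p_3(y,z),\;y+q_2z^2+q_3z^3)$, where $p_i\in\mathbf{k}[y,z]$ is homogeneous of degree $i$ and $q_2,q_3\in\mathbf{k}$; 5. $(yz+z\,a_2(x,z)+x,\;y+a_2(x,z)+r_1z+r_2z^2+r_3z^3)$, where $a_2\in\mathbf{k}[x,z]\setminus\mathbf{k}[z]$ is homogeneous of degree $2$ and $r_1,r_2,r_3\in\mathbf{k}$; 6. $(yz+z\,a_2(x,z)+x,\;z)$, where $a_2\in\mathbf{k}[x,z]\setminus\mathbf{k}[z]$ is homogeneous of degree $2$; 7. $(xy^2+y(z^2+az+b)+z,\;y)$, where $a,b\in\mathbf{k}$; 8. $(x+z^2+y^3,\;y+x^2)$, only if $\operatorname{char}\mathbf{k}=2$;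 9. $(x+z^2+y^3,\;z+x^3)$, only if $\operatorname{char}\mathbf{k}=3$; 10. $(x+p_2(y,z)+p_3(y,z),\;y+q_2z^2+q_3z^3,\;z)$, where $p_i\in\mathbf{k}[y,z]$ is homogeneous of degree $i$ and $q_2,q_3\in\mathbf{k}$; 11. $(yz+z\,a_2(x,z)+x,\;y+a_2(x,z)+r_2z^2+r_3z^3,\;z)$, where $a_2\in\mathbf{k}[x,z]\setminus\mathbf{k}[z]$ is homogeneous of degree $2$ and $r_2,r_3\in\mathbf{k}$. **Proposition.** These eleven families define disjoint sets of equivalence classes of affine linear systems of affine spaces. That is, every member of each family is an affine linear system of affine spaces, and if $f,g\colon\mathbb{A}^3\to\mathbb{A}^n$ are equivalent and belong to the families $(k)$ and $(l)$, respectively, then $k=l$. In particular, for each $a\in\mathbf{k}[x,z]\setminus\mathbf{k}[z]$ homogeneous of degree $2$ and each $r\in\mathbf{k}[z]$ of degree $\le 3$, the morphism $$(x+yz+z\,a(x,z),\;y+a(x,z)+r(z),\;z)$$ is an automorphism of $\mathbb{A}^3$ that is not equivalent to any triangular automorphism of $\mathbb{A}^3$. -/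

import Mathlib

open MvPolynomial

noncomputable section

/-- A morphism `𝔸ᵈ → 𝔸ⁿ` over `K`, given by its `n` component polynomials in `d` variables. -/
abbrev PolyMap (K : Type*) [CommRing K] (d n : ℕ) : Type _ :=
  Fin n → MvPolynomial (Fin d) K

namespace PolyMap

variable {K : Type*} [Field K]

/-- Composition of morphisms: `g ∘ f : 𝔸ᵈ → 𝔸ⁿ → 𝔸ᵐ` is the substitution of `f` into `g`. -/
def comp {d n m : ℕ} (g : PolyMap K n m) (f : PolyMap K d n) : PolyMap K d m :=
  fun i => bind₁ f (g i)

/-- The identity morphism of `𝔸ⁿ`. -/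
def idMap (K : Type*) [Field K] (n : ℕ) : PolyMap K n n := fun i => X i

/-- `f` is an automorphism of `𝔸ⁿ`. -/
def IsAutomorphism {n : ℕ} (f : PolyMap K n n) : Prop :=
  ∃ g : PolyMap K n n, comp g f = idMap K n ∧ comp f g = idMap K n

/-- Affine automorphisms: automorphisms all of whose components have degree `1`. -/
def IsAffineAutomorphism {n : ℕ} (f : PolyMap K n n) : Prop :=
  IsAutomorphism f ∧ ∀ i, (f i).totalDegree = 1

/-- Triangular automorphisms: the `i`-th component is a polynomial in `x_i, …, x_n` only. -/
def IsTriangularAutomorphism {n : ℕ} (f : PolyMap K n n) : Prop :=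
  IsAutomorphism f ∧ ∀ i, f i ∈ supported K (Set.Ici i)

/-- `f` and `g` are equivalent: they agree up to affine automorphisms at source and target. -/
def AffineEquivalent {d n : ℕ} (f g : PolyMap K d n) : Prop :=
  ∃ (α : PolyMap K n n) (β : PolyMap K d d),
    IsAffineAutomorphism α ∧ IsAffineAutomorphism β ∧ f = comp α (comp g β)

/-- Affine linear systems of affine spaces: for every `λ₀ ∈ K` and `(λ₁, …, λₙ) ≠ 0` the polynomial
`λ₀ + λ₁ f₁ + ⋯ + λₙ fₙ` is not constant and the (schematic) hypersurface of `𝔸ᵈ` it defines is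
isomorphic over `K` to `𝔸ᵈ⁻¹` (expressed through the coordinate rings). -/
def IsAffineLinearSystemOfAffineSpaces {d n : ℕ} (f : PolyMap K d n) : Prop :=
  ∀ (c₀ : K) (c : Fin n → K), c ≠ 0 →
    (∀ b : K, C c₀ + ∑ i, C (c i) * f i ≠ C b) ∧
    Nonempty ((MvPolynomial (Fin d) K ⧸
        Ideal.span ({C c₀ + ∑ i, C (c i) * f i} : Set (MvPolynomial (Fin d) K)))
      ≃ₐ[K] MvPolynomial (Fin (d - 1)) K)

/-- `InFamily k f` says that `f : 𝔸³ → 𝔸ⁿ` is a member of the `k`-th of the eleven families.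
The coordinates `x, y, z` of `𝔸³` are `X 0, X 1, X 2`; the subring `K[y, z]` of `K[x, y, z]` is
`supported K {1, 2}`, and so on. The zero polynomial is homogeneous of every degree. -/
inductive InFamily : ℕ → ∀ {n : ℕ}, PolyMap K 3 n → Prop
  /- variables of `K[x, y, z]` -/
  | case1 (r₂ r₃ : MvPolynomial (Fin 3) K)
      (h₂ : r₂ ∈ supported K {1, 2}) (h₂' : r₂.IsHomogeneous 2)
      (h₃ : r₃ ∈ supported K {1, 2}) (h₃' : r₃.IsHomogeneous 3) :
      InFamily 1 ![X 0 + r₂ + r₃]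
  | case2 (r₂ : MvPolynomial (Fin 3) K)
      (h : r₂ ∈ supported K {1, 2}) (h' : r₂ ∉ supported K {1}) (h'' : r₂.IsHomogeneous 2) :
      InFamily 2 ![X 0 * X 1 + X 1 * r₂ + X 2]
  | case3 (a b : K) :
      InFamily 3 ![X 0 * X 1 ^ 2 + X 1 * (X 2 ^ 2 + C a * X 2 + C b) + X 2]
  /- trivial `𝔸¹`-fibrations -/
  | case4 (p₂ p₃ : MvPolynomial (Fin 3) K) (q₂ q₃ : K)
      (h₂ : p₂ ∈ supported K {1, 2}) (h₂' : p₂.IsHomogeneous 2)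
      (h₃ : p₃ ∈ supported K {1, 2}) (h₃' : p₃.IsHomogeneous 3) :
      InFamily 4 ![X 0 + p₂ + p₃, X 1 + C q₂ * X 2 ^ 2 + C q₃ * X 2 ^ 3]
  | case5 (a₂ : MvPolynomial (Fin 3) K) (r₁ r₂ r₃ : K)
      (h : a₂ ∈ supported K {0, 2}) (h' : a₂ ∉ supported K {2}) (h'' : a₂.IsHomogeneous 2) :
      InFamily 5 ![X 1 * X 2 + X 2 * a₂ + X 0,
        X 1 + a₂ + C r₁ * X 2 + C r₂ * X 2 ^ 2 + C r₃ * X 2 ^ 3]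
  | case6 (a₂ : MvPolynomial (Fin 3) K)
      (h : a₂ ∈ supported K {0, 2}) (h' : a₂ ∉ supported K {2}) (h'' : a₂.IsHomogeneous 2) :
      InFamily 6 ![X 1 * X 2 + X 2 * a₂ + X 0, X 2]
  | case7 (a b : K) :
      InFamily 7 ![X 0 * X 1 ^ 2 + X 1 * (X 2 ^ 2 + C a * X 2 + C b) + X 2, X 1]
  /- non-trivial `𝔸¹`-fibrations -/
  | case8 (hK : CharP K 2) :
      InFamily 8 ![X 0 + X 2 ^ 2 + X 1 ^ 3, X 1 + X 0 ^ 2]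
  | case9 (hK : CharP K 3) :
      InFamily 9 ![X 0 + X 2 ^ 2 + X 1 ^ 3, X 2 + X 0 ^ 3]
  /- automorphisms of `𝔸³` -/
  | case10 (p₂ p₃ : MvPolynomial (Fin 3) K) (q₂ q₃ : K)
      (h₂ : p₂ ∈ supported K {1, 2}) (h₂' : p₂.IsHomogeneous 2)
      (h₃ : p₃ ∈ supported K {1, 2}) (h₃' : p₃.IsHomogeneous 3) :
      InFamily 10 ![X 0 + p₂ + p₃, X 1 + C q₂ * X 2 ^ 2 + C q₃ * X 2 ^ 3, X 2]
  | case11 (a₂ : MvPolynomial (Fin 3) K) (r₂ r₃ : K)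
      (h : a₂ ∈ supported K {0, 2}) (h' : a₂ ∉ supported K {2}) (h'' : a₂.IsHomogeneous 2) :
      InFamily 11 ![X 1 * X 2 + X 2 * a₂ + X 0,
        X 1 + a₂ + C r₂ * X 2 ^ 2 + C r₃ * X 2 ^ 3, X 2]

/-- The morphism `(x + yz + z a, y + a + r, z) : 𝔸³ → 𝔸³`. -/
def starMap (a r : MvPolynomial (Fin 3) K) : PolyMap K 3 3 :=
  ![X 0 + X 1 * X 2 + X 2 * a, X 1 + a + r, X 2]

end PolyMap

end

namespace PolyMap

section Coordinates

variable {K : Type*} [Field K]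

lemma bind₁_eq_self_of_mem_supported {σ : Type*} {s : Set σ} {p : MvPolynomial σ K}
    (hp : p ∈ supported K s) {g : σ → MvPolynomial σ K} (hg : ∀ i ∈ s, g i = X i) :
    bind₁ g p = p := by
  have h := eval₂Hom_congr' (f₁ := (C : K →+* MvPolynomial σ K)) (f₂ := C) (g₁ := g) (g₂ := X)
    (p₁ := p) (p₂ := p) rfl (fun i hi _ => hg i (mem_supported.1 hp hi)) rfl
  rw [bind₁]
  simpa [aeval_def, algebraMap_eq] using h

lemma eval_eq_of_mem_supported {σ : Type*} {s : Set σ} {p : MvPolynomial σ K}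
    (hp : p ∈ supported K s) {u v : σ → K} (huv : ∀ i ∈ s, u i = v i) :
    eval u p = eval v p :=
  eval₂Hom_congr' rfl (fun i hi _ => huv i (mem_supported.1 hp hi)) rfl

lemma comp_assoc {d n m l : ℕ} (h : PolyMap K m l) (g : PolyMap K n m) (f : PolyMap K d n) :
    comp (comp h g) f = comp h (comp g f) := by
  funext i
  simp only [comp]
  rw [bind₁_bind₁]
  rfl

lemma idMap_comp {d n : ℕ} (f : PolyMap K d n) : comp (idMap K n) f = f := by
  funext i
  simp [comp, idMap]

lemma IsAutomorphism.comp {n : ℕ} {f g : PolyMap K n n} (hf : IsAutomorphism f)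
    (hg : IsAutomorphism g) : IsAutomorphism (comp f g) := by
  obtain ⟨f', h₁, h₂⟩ := hf
  obtain ⟨g', h₃, h₄⟩ := hg
  refine ⟨PolyMap.comp g' f', ?_, ?_⟩
  · rw [comp_assoc, ← comp_assoc f', h₁, idMap_comp, h₃]
  · rw [comp_assoc, ← comp_assoc g, h₄, idMap_comp, h₂]

/-- Elementary automorphisms. -/
lemma isAutomorphism_update {n : ℕ} (i : Fin n) {p : MvPolynomial (Fin n) K}
    (hp : p ∈ supported K {i}ᶜ) : IsAutomorphism (Function.update (idMap K n) i (X i + p)) := by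
  have key : ∀ q : MvPolynomial (Fin n) K, bind₁ (Function.update (idMap K n) i q) p = p := fun q =>
    bind₁_eq_self_of_mem_supported hp fun j hj => by
      rw [Function.update_of_ne (by simpa using hj)]; rfl
  refine ⟨Function.update (idMap K n) i (X i - p), ?_, ?_⟩ <;>
  · funext j
    by_cases hj : j = i
    · subst hj; simp [PolyMap.comp, key, idMap]
    · simp [PolyMap.comp, hj, idMap]

/-- A presentation of `B` as the quotient of a polynomial ring by an ideal `I`. -/
noncomputable def quotientEquivOfSection {σ B : Type*} [CommRing B] [Algebra K B]
    (I : Ideal (MvPolynomial σ K)) (ψ : MvPolynomial σ K →ₐ[K] B) (s : B →ₐ[K] MvPolynomial σ K)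
    (hψ : ∀ a ∈ I, ψ a = 0) (hs : ψ.comp s = AlgHom.id K B)
    (hX : ∀ i, X i - s (ψ (X i)) ∈ I) : (MvPolynomial σ K ⧸ I) ≃ₐ[K] B :=
  AlgEquiv.ofAlgHom (Ideal.Quotient.liftₐ I ψ hψ) ((Ideal.Quotient.mkₐ K I).comp s)
    (AlgHom.ext fun b => DFunLike.congr_fun hs b)
    (by
      apply Ideal.Quotient.algHom_ext
      apply MvPolynomial.algHom_ext
      intro i
      exact ((Ideal.Quotient.mk_eq_mk_iff_sub_mem _ _).2 (hX i)).symm)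

/-- A hyperplane of `𝔸ᵐ⁺¹` is isomorphic to `𝔸ᵐ`. -/
lemma nonempty_hyperplane_equiv {m : ℕ} (c₀ : K) (c : Fin (m + 1) → K) (hc : c ≠ 0) :
    Nonempty ((MvPolynomial (Fin (m + 1)) K ⧸
        Ideal.span ({C c₀ + ∑ i, C (c i) * X i} : Set (MvPolynomial (Fin (m + 1)) K)))
      ≃ₐ[K] MvPolynomial (Fin m) K) := by
  obtain ⟨j, hj⟩ := Function.ne_iff.1 hc
  simp only [Pi.zero_apply] at hj
  set h : MvPolynomial (Fin (m + 1)) K := C c₀ + ∑ i, C (c i) * X i with hh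
  have hsum : h = C c₀ + (C (c j) * X j + ∑ i, C (c (j.succAbove i)) * X (j.succAbove i)) := by
    rw [hh, Fin.sum_univ_succAbove _ j]
  let ψ : MvPolynomial (Fin (m + 1)) K →ₐ[K] MvPolynomial (Fin m) K :=
    aeval (j.insertNth (-C (c j)⁻¹ * (C c₀ + ∑ i, C (c (j.succAbove i)) * X i)) X)
  let s : MvPolynomial (Fin m) K →ₐ[K] MvPolynomial (Fin (m + 1)) K :=
    aeval fun i => X (j.succAbove i)
  have hcc : ∀ {n : ℕ}, (C (c j) : MvPolynomial (Fin n) K) * C (c j)⁻¹ = 1 := by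
    intro n; rw [← C_mul, mul_inv_cancel₀ hj, C_1]
  have hC : ∀ a, ψ (C a) = C a := fun a => ψ.commutes a
  have hC' : ∀ a, s (C a) = C a := fun a => s.commutes a
  have hj' : ψ (X j) = -C (c j)⁻¹ * (C c₀ + ∑ i, C (c (j.succAbove i)) * X i) := by simp [ψ]
  have hi' : ∀ i, ψ (X (j.succAbove i)) = X i := by simp [ψ]
  have hsi : ∀ i, s (X i) = X (j.succAbove i) := by simp [s]
  refine ⟨quotientEquivOfSection _ ψ s ?_ ?_ ?_⟩
  · have : ψ h = 0 := by
      rw [hsum]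
      simp only [map_add, map_mul, map_sum, hC, hj', hi']
      linear_combination (-(C c₀ + ∑ i, C (c (j.succAbove i)) * X i)) * hcc (n := m)
    intro a ha
    obtain ⟨b, rfl⟩ := Ideal.mem_span_singleton'.1 ha
    rw [map_mul, this, mul_zero]
  · apply MvPolynomial.algHom_ext
    intro i
    simp [hsi, hi']
  · intro i
    obtain rfl | ⟨k, rfl⟩ := Fin.eq_self_or_eq_succAbove j i
    · refine Ideal.mem_span_singleton'.2 ⟨C (c i)⁻¹, ?_⟩
      rw [hj', hsum]
      simp only [map_add, map_neg, map_mul, map_sum, hC', hsi]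
      linear_combination (X i) * hcc (n := m + 1)
    · rw [hi', hsi, sub_self]; exact Ideal.zero_mem _

/-- Affine combinations of the components of an automorphism define hypersurfaces isomorphic to
affine space. -/
lemma IsAutomorphism.hypersurface {m : ℕ} {f : PolyMap K (m + 1) (m + 1)} (hf : IsAutomorphism f)
    (c₀ : K) (c : Fin (m + 1) → K) (hc : c ≠ 0) {h : MvPolynomial (Fin (m + 1)) K}
    (hh : h = C c₀ + ∑ i, C (c i) * f i) :
    (∀ b : K, h ≠ C b) ∧ Nonempty ((MvPolynomial (Fin (m + 1)) K ⧸
        Ideal.span ({h} : Set (MvPolynomial (Fin (m + 1)) K)))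
      ≃ₐ[K] MvPolynomial (Fin m) K) := by
  obtain ⟨g, h₁, h₂⟩ := hf
  have e₁ : (bind₁ f).comp (bind₁ g) = AlgHom.id K _ := by
    apply MvPolynomial.algHom_ext
    intro i
    simpa [PolyMap.comp, idMap] using congrFun h₁ i
  have e₂ : (bind₁ g).comp (bind₁ f) = AlgHom.id K _ := by
    apply MvPolynomial.algHom_ext
    intro i
    simpa [PolyMap.comp, idMap] using congrFun h₂ i
  let φ := AlgEquiv.ofAlgHom (bind₁ f) (bind₁ g) e₁ e₂
  have hφ : φ (C c₀ + ∑ i, C (c i) * X i) = h := by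
    rw [hh]
    simp [φ]
  constructor
  · intro b hb
    have h' : (C c₀ + ∑ i, C (c i) * X i : MvPolynomial (Fin (m + 1)) K) = C b := by
      apply φ.injective
      rw [hφ, hb]
      exact (φ.commutes b).symm
    apply hc
    funext j
    have h0 := congrArg (eval 0) h'
    have h1 := congrArg (eval (Pi.single j 1)) h'
    simp [Pi.single_apply] at h0 h1
    simpa [h0] using h1
  · obtain ⟨e⟩ := nonempty_hyperplane_equiv c₀ c hc
    refine ⟨AlgEquiv.trans (AlgEquiv.symm (Ideal.quotientEquivAlg _ _ φ ?_)) e⟩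
    rw [Ideal.map_span, Set.image_singleton]
    congr 2
    exact hφ.symm

lemma supported_compl_of_notMem {σ : Type*} {s : Set σ} {i : σ} (hi : i ∉ s)
    {p : MvPolynomial σ K} (hp : p ∈ supported K s) : p ∈ supported K {i}ᶜ :=
  supported_mono (Set.subset_compl_singleton_iff.2 hi) hp

lemma C_mul_X_pow_mem_supported {σ : Type*} {s : Set σ} (r : K) (n : ℕ) {i : σ} (hi : i ∈ s) :
    (C r * X i ^ n : MvPolynomial σ K) ∈ supported K s := by
  have hC : (C r : MvPolynomial σ K) ∈ supported K s := (supported K s).algebraMap_mem r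
  have hX : (X i : MvPolynomial σ K) ∈ supported K s := X_mem_supported.2 hi
  exact mul_mem hC (pow_mem hX n)

/-- Explicit form of triangular automorphisms with unit diagonal. -/
lemma isAutomorphism_triangular {p q : MvPolynomial (Fin 3) K} (hp : p ∈ supported K {1, 2})
    (hq : q ∈ supported K {2}) : IsAutomorphism ![X 0 + p, X 1 + q, X 2] := by
  have h := (isAutomorphism_update 1 (supported_compl_of_notMem (by decide) hq)).comp
    (isAutomorphism_update 0 (supported_compl_of_notMem (by decide) hp))
  have hq' : bind₁ (Function.update (idMap K 3) 0 (X 0 + p)) q = q :=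
    bind₁_eq_self_of_mem_supported hq fun i hi => by
      rw [Set.mem_singleton_iff] at hi; subst hi; rfl
  convert h using 1
  funext i
  fin_cases i <;> simp [PolyMap.comp, hq', idMap]

lemma isAutomorphism_starMap {a r : MvPolynomial (Fin 3) K} (ha : a ∈ supported K {0, 2})
    (hr : r ∈ supported K {2}) : IsAutomorphism (starMap a r) := by
  have hX : (X 1 * X 2 : MvPolynomial (Fin 3) K) ∈ supported K {0}ᶜ :=
    mul_mem (X_mem_supported.2 (by decide)) (X_mem_supported.2 (by decide))
  have h := (isAutomorphism_update 1 (supported_compl_of_notMem (by decide) hr)).comp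
    ((isAutomorphism_update 0 hX).comp
      (isAutomorphism_update 1 (supported_compl_of_notMem (by decide) ha)))
  convert h using 1
  have hr' : bind₁ (PolyMap.comp (Function.update (idMap K 3) 0 (X 0 + X 1 * X 2))
      (Function.update (idMap K 3) 1 (X 1 + a))) r = r :=
    bind₁_eq_self_of_mem_supported hr fun i hi => by
      rw [Set.mem_singleton_iff] at hi; subst hi; simp [PolyMap.comp, idMap]
  funext i
  fin_cases i
  · simp [PolyMap.comp, idMap, starMap]; ring
  · change X 1 + a + r = bind₁ _ (Function.update (idMap K 3) 1 (X 1 + r) 1)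
    rw [Function.update_self, map_add, hr', bind₁_X_right]
    simp [PolyMap.comp, idMap]
  · simp [PolyMap.comp, idMap, starMap]

lemma isAutomorphism_case2 {r : MvPolynomial (Fin 3) K} (hr : r ∈ supported K {1, 2}) :
    IsAutomorphism ![X 0 * X 1 + X 1 * r + X 2, X 0 + r, X 1] := by
  have hX : (X 0 * X 1 : MvPolynomial (Fin 3) K) ∈ supported K {2}ᶜ :=
    mul_mem (X_mem_supported.2 (by decide)) (X_mem_supported.2 (by decide))
  have hp : IsAutomorphism (![X 2, X 0, X 1] : PolyMap K 3 3) := by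
    refine ⟨![X 1, X 2, X 0], ?_, ?_⟩ <;>
    · funext i
      fin_cases i <;> simp [PolyMap.comp, idMap]
  have h := hp.comp ((isAutomorphism_update 2 hX).comp
    (isAutomorphism_update 0 (supported_compl_of_notMem (by decide) hr)))
  convert h using 1
  funext i
  fin_cases i
  · simp [PolyMap.comp, idMap]; ring
  · simp [PolyMap.comp, idMap]
  · simp [PolyMap.comp, idMap]

lemma isAutomorphism_case7 (a b : K) :
    IsAutomorphism ![X 0 * X 1 ^ 2 + X 1 * (X 2 ^ 2 + C a * X 2 + C b) + X 2, X 1,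
      -X 0 + (X 2 ^ 2 + C a * X 2 + C b + X 0 * X 1) *
        (X 2 + (X 0 * X 1 ^ 2 + X 1 * (X 2 ^ 2 + C a * X 2 + C b) + X 2) + C a)] := by
  refine ⟨![-X 2 + (X 0 ^ 2 + C a * X 0 + C b - X 1 * X 2) *
      (X 0 - X 1 * (X 0 ^ 2 + C a * X 0 + C b) + X 1 ^ 2 * X 2 + X 0 + C a), X 1,
      X 0 - X 1 * (X 0 ^ 2 + C a * X 0 + C b) + X 1 ^ 2 * X 2], ?_, ?_⟩ <;>
  · funext i
    fin_cases i <;> simp [PolyMap.comp, idMap] <;> ring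

lemma isAffineLinearSystem_case8 [IsAlgClosed K] (hK : CharP K 2) :
    IsAffineLinearSystemOfAffineSpaces (![X 0 + X 2 ^ 2 + X 1 ^ 3, X 1 + X 0 ^ 2] : PolyMap K 3 2) := by
  intro c₀ c hc
  by_cases h0 : c 0 = 0
  · have hA : IsAutomorphism (![X 1 + X 0 ^ 2, X 0, X 2] : PolyMap K 3 3) := by
      refine ⟨![X 1, X 0 - X 1 ^ 2, X 2], ?_, ?_⟩ <;>
      · funext i
        fin_cases i <;> simp [PolyMap.comp, idMap]
    refine hA.hypersurface c₀ ![c 1, 0, 0] (fun h => hc ?_) ?_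
    · funext i; fin_cases i; exacts [h0, congrFun h 0]
    · simp [Fin.sum_univ_three, h0]
  · obtain ⟨ν, hν⟩ := IsAlgClosed.exists_pow_nat_eq (c 1 / c 0) (n := 2) (by norm_num)
    have hA : IsAutomorphism (![X 0 + (X 2 + C ν * X 0) ^ 2 + X 1 ^ 3 + C ν ^ 2 * X 1, X 1,
        X 2 + C ν * X 0] : PolyMap K 3 3) := by
      refine ⟨![X 0 - X 2 ^ 2 - X 1 ^ 3 - C ν ^ 2 * X 1, X 1,
        X 2 - C ν * (X 0 - X 2 ^ 2 - X 1 ^ 3 - C ν ^ 2 * X 1)], ?_, ?_⟩ <;>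
      · funext i
        fin_cases i <;> simp [PolyMap.comp, idMap] <;> ring
    refine hA.hypersurface c₀ ![c 0, 0, 0] (fun h => h0 (congrFun h 0)) ?_
    have h1 : c 1 = c 0 * ν ^ 2 := by rw [hν]; field_simp
    have h2 : (2 : MvPolynomial (Fin 3) K) = 0 := CharTwo.two_eq_zero
    simp [Fin.sum_univ_three, h1]
    linear_combination (-(C (c 0) * C ν * X 0 * X 2)) * h2

lemma isAffineLinearSystem_case9 [IsAlgClosed K] (hK : CharP K 3) :
    IsAffineLinearSystemOfAffineSpaces (![X 0 + X 2 ^ 2 + X 1 ^ 3, X 2 + X 0 ^ 3] : PolyMap K 3 2) := by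
  intro c₀ c hc
  by_cases h0 : c 0 = 0
  · have hA : IsAutomorphism (![X 2 + X 0 ^ 3, X 1, X 0] : PolyMap K 3 3) := by
      refine ⟨![X 2, X 1, X 0 - X 2 ^ 3], ?_, ?_⟩ <;>
      · funext i
        fin_cases i <;> simp [PolyMap.comp, idMap]
    refine hA.hypersurface c₀ ![c 1, 0, 0] (fun h => hc ?_) ?_
    · funext i; fin_cases i; exacts [h0, congrFun h 0]
    · simp [Fin.sum_univ_three, h0]
  · obtain ⟨ν, hν⟩ := IsAlgClosed.exists_pow_nat_eq (c 1 / c 0) (n := 3) (by norm_num)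
    have hA : IsAutomorphism (![X 0 + X 2 ^ 2 + (X 1 + C ν * X 0) ^ 3 + C ν ^ 3 * X 2,
        X 1 + C ν * X 0, X 2] : PolyMap K 3 3) := by
      refine ⟨![X 0 - X 2 ^ 2 - X 1 ^ 3 - C ν ^ 3 * X 2,
        X 1 - C ν * (X 0 - X 2 ^ 2 - X 1 ^ 3 - C ν ^ 3 * X 2), X 2], ?_, ?_⟩ <;>
      · funext i
        fin_cases i <;> simp [PolyMap.comp, idMap] <;> ring
    refine hA.hypersurface c₀ ![c 0, 0, 0] (fun h => h0 (congrFun h 0)) ?_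
    have h1 : c 1 = c 0 * ν ^ 3 := by rw [hν]; field_simp
    have h3 : (3 : MvPolynomial (Fin 3) K) = 0 := by
      exact_mod_cast CharP.cast_eq_zero (MvPolynomial (Fin 3) K) 3
    simp [Fin.sum_univ_three, h1]
    linear_combination (-(C (c 0) * (C ν * X 0 * X 1 ^ 2 + C ν ^ 2 * X 0 ^ 2 * X 1))) * h3

lemma isAffineLinearSystem_of_inFamily [IsAlgClosed K] {k n : ℕ} {f : PolyMap K 3 n}
    (hf : InFamily k f) : IsAffineLinearSystemOfAffineSpaces f := by
  have one : ∀ {c : Fin 1 → K}, c ≠ 0 → ![c 0, 0, 0] ≠ 0 := fun {c} hc h => hc <| by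
    funext i; fin_cases i; exact congrFun h 0
  have two : ∀ {c : Fin 2 → K}, c ≠ 0 → ![c 0, c 1, 0] ≠ 0 := fun {c} hc h => hc <| by
    funext i; fin_cases i; exacts [congrFun h 0, congrFun h 1]
  have two' : ∀ {c : Fin 2 → K}, c ≠ 0 → ![c 0, 0, c 1] ≠ 0 := fun {c} hc h => hc <| by
    funext i; fin_cases i; exacts [congrFun h 0, congrFun h 2]
  have hz := fun r n => C_mul_X_pow_mem_supported (K := K) r n (Set.mem_singleton (2 : Fin 3))
  cases hf with
  | case1 r₂ r₃ h₂ h₂' h₃ h₃' =>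
    intro c₀ c hc
    refine (isAutomorphism_triangular (add_mem h₂ h₃) (zero_mem _)).hypersurface c₀ _ (one hc) ?_
    simp [Fin.sum_univ_three, add_assoc]
  | case2 r₂ h h' h'' =>
    intro c₀ c hc
    refine (isAutomorphism_case2 h).hypersurface c₀ _ (one hc) ?_
    simp [Fin.sum_univ_three]
  | case3 a b =>
    intro c₀ c hc
    refine (isAutomorphism_case7 a b).hypersurface c₀ _ (one hc) ?_
    simp [Fin.sum_univ_three]
  | case4 p₂ p₃ q₂ q₃ h₂ h₂' h₃ h₃' =>
    intro c₀ c hc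
    refine (isAutomorphism_triangular (add_mem h₂ h₃)
      (add_mem (hz q₂ 2) (hz q₃ 3))).hypersurface c₀ _ (two hc) ?_
    simp [Fin.sum_univ_three, add_assoc]
  | case5 a₂ r₁ r₂ r₃ h h' h'' =>
    have h1 := hz r₁ 1
    rw [pow_one] at h1
    intro c₀ c hc
    refine (isAutomorphism_starMap h
      (add_mem (add_mem h1 (hz r₂ 2)) (hz r₃ 3))).hypersurface c₀ _ (two hc) ?_
    simp [Fin.sum_univ_three, starMap]
    ring
  | case6 a₂ h h' h'' =>
    intro c₀ c hc
    refine (isAutomorphism_starMap h (zero_mem _)).hypersurface c₀ _ (two' hc) ?_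
    simp [Fin.sum_univ_three, starMap]
    exact Or.inl (by ring)
  | case7 a b =>
    intro c₀ c hc
    refine (isAutomorphism_case7 a b).hypersurface c₀ _ (two hc) ?_
    simp [Fin.sum_univ_three]
  | case8 hK => exact isAffineLinearSystem_case8 hK
  | case9 hK => exact isAffineLinearSystem_case9 hK
  | case10 p₂ p₃ q₂ q₃ h₂ h₂' h₃ h₃' =>
    intro c₀ c hc
    refine (isAutomorphism_triangular (add_mem h₂ h₃)
      (add_mem (hz q₂ 2) (hz q₃ 3))).hypersurface c₀ _ hc ?_
    simp [Fin.sum_univ_three, add_assoc]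
  | case11 a₂ r₂ r₃ h h' h'' =>
    intro c₀ c hc
    refine (isAutomorphism_starMap h
      (add_mem (hz r₂ 2) (hz r₃ 3))).hypersurface c₀ _ hc ?_
    simp [Fin.sum_univ_three, starMap]
    ring

end Coordinates

end PolyMap

namespace PolyMap

section Invariants

variable {K : Type*} [Field K]

/-- The map on `K`-points defined by a morphism. -/
noncomputable def pointMap {d n : ℕ} (f : PolyMap K d n) (p : Fin d → K) : Fin n → K := fun i => eval p (f i)

lemma pointMap_comp {d n m : ℕ} (g : PolyMap K n m) (f : PolyMap K d n) (p : Fin d → K) :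
    pointMap (comp g f) p = pointMap g (pointMap f p) := by
  funext i
  exact aeval_bind₁ p f (g i)

lemma pointMap_idMap {n : ℕ} (p : Fin n → K) : pointMap (idMap K n) p = p := by
  funext i; simp [pointMap, idMap]

lemma eval_eq_of_totalDegree_le_one {n : ℕ} {q : MvPolynomial (Fin n) K} (hq : q.totalDegree ≤ 1)
    (p : Fin n → K) : eval p q = ∑ j, q.coeff (Finsupp.single j 1) * p j + q.coeff 0 := by
  classical
  have hsub : q.support ⊆ insert 0 (Finset.univ.image fun j => Finsupp.single j 1) := by
    intro d hd
    have h1 : d.degree ≤ 1 := by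
      exact (le_totalDegree hd).trans hq
    rw [Finset.mem_insert, Finset.mem_image]
    rcases Nat.le_one_iff_eq_zero_or_eq_one.1 h1 with h | h
    · exact Or.inl ((Finsupp.degree_eq_zero_iff d).1 h)
    · obtain ⟨i, hi⟩ := (Finsupp.sum_eq_one_iff d).1 h
      exact Or.inr ⟨i, Finset.mem_univ _, hi.symm⟩
  rw [eval_eq, Finset.sum_subset hsub fun d _ hd => by
    rw [notMem_support_iff.1 hd, zero_mul]]
  rw [Finset.sum_insert (by simp [eq_comm]), Finset.sum_image, add_comm]
  · congr 1
    · refine Finset.sum_congr rfl fun j _ => ?_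
      rw [Finset.prod_eq_single j] <;> simp +contextual [eq_comm]
    · simp
  · intro i _ j _ h
    exact Finsupp.single_left_injective one_ne_zero h

/-- Two maps that agree up to affine bijections of source and target. -/
def AffineConj {d n : ℕ} (F G : (Fin d → K) → (Fin n → K)) : Prop :=
  ∃ (A : (Fin n → K) ≃ₗ[K] (Fin n → K)) (a : Fin n → K) (B : (Fin d → K) ≃ₗ[K] (Fin d → K))
    (b : Fin d → K), ∀ p, F p = A (G (B p + b)) + a

lemma AffineConj.symm {d n : ℕ} {F G : (Fin d → K) → (Fin n → K)} (h : AffineConj F G) :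
    AffineConj G F := by
  obtain ⟨A, a, B, b, h⟩ := h
  refine ⟨A.symm, -A.symm a, B.symm, -B.symm b, fun p => ?_⟩
  simp [h]

lemma IsAffineAutomorphism.exists_linearEquiv {n : ℕ} {α : PolyMap K n n}
    (hα : IsAffineAutomorphism α) :
    ∃ (A : (Fin n → K) ≃ₗ[K] (Fin n → K)) (a : Fin n → K), ∀ p, pointMap α p = A p + a := by
  obtain ⟨⟨g, h, -⟩, hd⟩ := hα
  let M : Matrix (Fin n) (Fin n) K := fun i j => (α i).coeff (Finsupp.single j 1)
  have hM : ∀ p, pointMap α p = M.mulVecLin p + fun i => (α i).coeff 0 := fun p => by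
    funext i
    simp only [pointMap, eval_eq_of_totalDegree_le_one (hd i).le, Matrix.mulVecLin_apply]
    rfl
  have hinj : Function.Injective M.mulVecLin := fun p q hpq => by
    have h' : pointMap α p = pointMap α q := by rw [hM, hM, hpq]
    have h'' := congrArg (pointMap g) h'
    rwa [← pointMap_comp, ← pointMap_comp, h, pointMap_idMap, pointMap_idMap] at h''
  exact ⟨LinearEquiv.ofInjectiveEndo _ hinj, _, hM⟩

lemma AffineEquivalent.affineConj {d n : ℕ} {f g : PolyMap K d n} (h : AffineEquivalent f g) :
    AffineConj (pointMap f) (pointMap g) := by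
  obtain ⟨α, β, hα, hβ, rfl⟩ := h
  obtain ⟨A, a, hA⟩ := hα.exists_linearEquiv
  obtain ⟨B, b, hB⟩ := hβ.exists_linearEquiv
  exact ⟨A, a, B, b, fun p => by rw [pointMap_comp, pointMap_comp, hA, hB]⟩

/-- Some translation changes the map by a constant, linearly in the length of the translation. -/
def HasConstantShift {d n : ℕ} (F : (Fin d → K) → (Fin n → K)) : Prop :=
  ∃ v ≠ 0, ∃ c, ∀ p (t : K), F (p + t • v) = F p + t • c

/-- Some translation changes the map by an affine map, linearly in the length of the
translation. -/
def HasAffineShift {d n : ℕ} (F : (Fin d → K) → (Fin n → K)) : Prop :=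
  ∃ v ≠ 0, ∃ (L : (Fin d → K) →ₗ[K] (Fin n → K)) (c : Fin n → K),
    ∀ p (t : K), F (p + t • v) = F p + t • (L p + c)

/-- Some nonzero linear functional of the map is affine. -/
def HasAffineFunctional {d n : ℕ} (F : (Fin d → K) → (Fin n → K)) : Prop :=
  ∃ l : (Fin n → K) →ₗ[K] K, l ≠ 0 ∧ ∃ (m : (Fin d → K) →ₗ[K] K) (c : K), ∀ p, l (F p) = m p + c

/-- Some translation changes the map in a fixed direction only. -/
def HasDirectedShift {d n : ℕ} (F : (Fin d → K) → (Fin n → K)) : Prop :=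
  ∃ v ≠ 0, ∃ w, ∀ p (t : K), ∃ s : K, F (p + t • v) = F p + s • w

variable {d n : ℕ} {F G : (Fin d → K) → (Fin n → K)}

lemma HasConstantShift.of_conj (h : AffineConj F G) (hG : HasConstantShift G) :
    HasConstantShift F := by
  obtain ⟨A, a, B, b, h⟩ := h
  obtain ⟨v, hv, c, hc⟩ := hG
  refine ⟨B.symm v, by simpa using hv, A c, fun p t => ?_⟩
  have : B (p + t • B.symm v) + b = B p + b + t • v := by simp; abel
  rw [h, h, this, hc]
  simp; abel

lemma HasAffineShift.of_conj (h : AffineConj F G) (hG : HasAffineShift G) : HasAffineShift F := by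
  obtain ⟨A, a, B, b, h⟩ := h
  obtain ⟨v, hv, L, c, hc⟩ := hG
  refine ⟨B.symm v, by simpa using hv, A.toLinearMap ∘ₗ L ∘ₗ B.toLinearMap, A (L b + c),
    fun p t => ?_⟩
  have : B (p + t • B.symm v) + b = B p + b + t • v := by simp; abel
  rw [h, h, this, hc]
  simp; abel

lemma HasAffineFunctional.of_conj (h : AffineConj F G) (hG : HasAffineFunctional G) :
    HasAffineFunctional F := by
  obtain ⟨A, a, B, b, h⟩ := h
  obtain ⟨l, hl, m, c, hc⟩ := hG
  refine ⟨l ∘ₗ A.symm.toLinearMap, fun h0 => hl ?_, m ∘ₗ B.toLinearMap, m b + c + l (A.symm a),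
    fun p => ?_⟩
  · ext i
    simpa using LinearMap.congr_fun h0 (A (Pi.single i 1))
  · rw [h]
    simp [hc]; ring

lemma HasDirectedShift.of_conj (h : AffineConj F G) (hG : HasDirectedShift G) :
    HasDirectedShift F := by
  obtain ⟨A, a, B, b, h⟩ := h
  obtain ⟨v, hv, w, hw⟩ := hG
  refine ⟨B.symm v, by simpa using hv, A w, fun p t => ?_⟩
  obtain ⟨s, hs⟩ := hw (B p + b) t
  refine ⟨s, ?_⟩
  have : B (p + t • B.symm v) + b = B p + b + t • v := by simp; abel
  rw [h, h, this, hs]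
  simp; abel

lemma HasConstantShift.hasAffineShift (h : HasConstantShift F) : HasAffineShift F := by
  obtain ⟨v, hv, c, hc⟩ := h
  exact ⟨v, hv, 0, c, by simpa using hc⟩

lemma vec_eq {R : Type*} (p : Fin 3 → R) : p = ![p 0, p 1, p 2] := by
  funext i; fin_cases i <;> rfl

lemma linear_apply_vec {n : ℕ} (L : (Fin n → K) →ₗ[K] K) (p : Fin n → K) :
    L p = ∑ i, L (Pi.single i 1) * p i := by
  rw [LinearMap.pi_apply_eq_sum_univ L p]
  refine Finset.sum_congr rfl fun i _ => ?_
  rw [smul_eq_mul, mul_comm]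
  congr 2
  funext j
  simp [Pi.single_apply, eq_comm]

lemma HasConstantShift.exists_coords {n : ℕ} {f : PolyMap K 3 n}
    (h : HasConstantShift (pointMap f)) :
    ∃ u v w : K, ¬ (u = 0 ∧ v = 0 ∧ w = 0) ∧ ∀ i, ∃ c, ∀ x y z t : K,
      eval ![x + t * u, y + t * v, z + t * w] (f i) = eval ![x, y, z] (f i) + t * c := by
  obtain ⟨v, hv, c, h⟩ := h
  refine ⟨v 0, v 1, v 2, fun h0 => hv ?_, fun i => ⟨c i, fun x y z t => ?_⟩⟩
  · rw [vec_eq v, h0.1, h0.2.1, h0.2.2]; simp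
  · have := congrFun (h ![x, y, z] t) i
    rw [vec_eq (![x, y, z] + t • v)] at this
    simpa [pointMap] using this

lemma HasAffineShift.exists_coords {n : ℕ} {f : PolyMap K 3 n} (h : HasAffineShift (pointMap f)) :
    ∃ u v w : K, ¬ (u = 0 ∧ v = 0 ∧ w = 0) ∧ ∀ i, ∃ l₀ l₁ l₂ c, ∀ x y z t : K,
      eval ![x + t * u, y + t * v, z + t * w] (f i) =
        eval ![x, y, z] (f i) + t * (l₀ * x + l₁ * y + l₂ * z + c) := by
  obtain ⟨v, hv, L, c, h⟩ := h
  refine ⟨v 0, v 1, v 2, fun h0 => hv ?_, fun i => ?_⟩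
  · rw [vec_eq v, h0.1, h0.2.1, h0.2.2]; simp
  · let L' := LinearMap.proj i ∘ₗ L
    refine ⟨L' (Pi.single 0 1), L' (Pi.single 1 1), L' (Pi.single 2 1), c i, fun x y z t => ?_⟩
    have := congrFun (h ![x, y, z] t) i
    rw [vec_eq (![x, y, z] + t • v)] at this
    have hL := linear_apply_vec L' ![x, y, z]
    simp only [Fin.sum_univ_three, Matrix.cons_val] at hL
    rw [← hL]
    simpa [pointMap, L', mul_add] using this

lemma HasAffineFunctional.exists_coords {f : PolyMap K 3 2}
    (h : HasAffineFunctional (pointMap f)) :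
    ∃ a b : K, ¬ (a = 0 ∧ b = 0) ∧ ∃ l₀ l₁ l₂ c, ∀ x y z : K,
      a * eval ![x, y, z] (f 0) + b * eval ![x, y, z] (f 1) = l₀ * x + l₁ * y + l₂ * z + c := by
  obtain ⟨l, hl, m, c, h⟩ := h
  refine ⟨l (Pi.single 0 1), l (Pi.single 1 1), fun h0 => hl ?_, m (Pi.single 0 1),
    m (Pi.single 1 1), m (Pi.single 2 1), c, fun x y z => ?_⟩
  · ext p
    rw [LinearMap.comp_apply, linear_apply_vec]
    simp [h0.1, h0.2]
  · have := h ![x, y, z]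
    rw [linear_apply_vec l, linear_apply_vec m] at this
    simpa [Fin.sum_univ_three, pointMap] using this

/-- A polynomial function of degree at most three that vanishes identically has zero
coefficients. -/
lemma cubic_coeffs_eq_zero [Infinite K] {a b c d : K}
    (h : ∀ t : K, a + b * t + c * t ^ 2 + d * t ^ 3 = 0) : a = 0 ∧ b = 0 ∧ c = 0 ∧ d = 0 := by
  have hp : Polynomial.C a + Polynomial.C b * Polynomial.X + Polynomial.C c * Polynomial.X ^ 2 +
      Polynomial.C d * Polynomial.X ^ 3 = 0 :=
    Polynomial.funext fun t => by simpa using h t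
  refine ⟨?_, ?_, ?_, ?_⟩
  · simpa [Polynomial.coeff_X, Polynomial.coeff_C] using congrArg (Polynomial.coeff · 0) hp
  · simpa [Polynomial.coeff_X, Polynomial.coeff_C] using congrArg (Polynomial.coeff · 1) hp
  · simpa [Polynomial.coeff_X, Polynomial.coeff_C] using congrArg (Polynomial.coeff · 2) hp
  · simpa [Polynomial.coeff_X, Polynomial.coeff_C] using congrArg (Polynomial.coeff · 3) hp

/-- Binary quadratic forms. -/
lemma exists_quadratic_form {σ : Type*} {i j : σ} (hij : i ≠ j) {q : MvPolynomial σ K}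
    (hq : q ∈ supported K {i, j}) (hq' : q.IsHomogeneous 2) :
    ∃ α β γ : K, q = C α * X i ^ 2 + C β * (X i * X j) + C γ * X j ^ 2 := by
  classical
  have hsub : q.support ⊆ (Finset.range 3).image fun k =>
      Finsupp.single i k + Finsupp.single j (2 - k) := by
    intro d hd
    have hdeg : d.degree = 2 := by
      have := hq' (mem_support_iff.1 hd)
      rw [Finsupp.degree_eq_weight_one]
      exact this
    have hds : d.support ⊆ {i, j} := fun k hk => by
      have := mem_supported.1 hq (Finset.mem_coe.2 ((mem_vars_iff_mem_support k).2 ⟨d, hd, hk⟩))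
      simpa using this
    have hd' : d = Finsupp.single i (d i) + Finsupp.single j (d j) := by
      ext k
      by_cases hk : k ∈ d.support
      · have := hds hk
        simp only [Finset.mem_insert, Finset.mem_singleton] at this
        rcases this with rfl | rfl
        · simp [hij.symm]
        · simp [hij]
      · rw [Finsupp.notMem_support_iff] at hk
        by_cases h1 : k = i
        · subst h1; simp [hk, hij.symm]
        · by_cases h2 : k = j
          · subst h2; simp [hk, hij]
          · simp [hk, Ne.symm h1, Ne.symm h2]
    rw [hd'] at hdeg
    simp at hdeg
    rw [Finset.mem_image]
    refine ⟨d i, by rw [Finset.mem_range]; omega, ?_⟩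
    rw [← hdeg, Nat.add_sub_cancel_left]
    exact hd'.symm
  refine ⟨q.coeff (Finsupp.single i 2 + Finsupp.single j 0),
    q.coeff (Finsupp.single i 1 + Finsupp.single j 1),
    q.coeff (Finsupp.single i 0 + Finsupp.single j 2), ?_⟩
  conv_lhs => rw [q.as_sum, Finset.sum_subset hsub fun d _ hd => by
    rw [notMem_support_iff.1 hd, monomial_zero]]
  rw [Finset.sum_image]
  · simp only [Finset.sum_range_succ, Finset.sum_range_zero, zero_add, monomial_eq]
    simp [Finsupp.prod_add_index', pow_add]
    ring
  · intro k _ l _ h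
    simpa [hij] using DFunLike.congr_fun h i

lemma exists_quadratic_form_of_notMem {σ : Type*} {i j : σ} (hij : i ≠ j) {q : MvPolynomial σ K}
    (hq : q ∈ supported K {i, j}) (hq₁ : q ∉ supported K {j}) (hq' : q.IsHomogeneous 2) :
    ∃ α β γ : K, ¬ (α = 0 ∧ β = 0) ∧
      q = C α * X i ^ 2 + C β * (X i * X j) + C γ * X j ^ 2 := by
  obtain ⟨α, β, γ, h⟩ := exists_quadratic_form hij hq hq'
  refine ⟨α, β, γ, fun h0 => hq₁ ?_, h⟩
  rw [h, h0.1, h0.2]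
  simpa using C_mul_X_pow_mem_supported γ 2 (Set.mem_singleton j)

end Invariants

end PolyMap

namespace PolyMap

section Families

variable {K : Type*} [Field K]

lemma eval_add_smul_single {n : ℕ} {i : Fin n} {q : MvPolynomial (Fin n) K}
    (hq : q ∈ supported K {i}ᶜ) (p : Fin n → K) (t : K) :
    eval (p + t • Pi.single i 1) q = eval p q :=
  eval_eq_of_mem_supported hq fun j hj => by
    simp [Pi.single_eq_of_ne (show j ≠ i from hj)]

lemma hasConstantShift_of_supported {n : ℕ} {f : PolyMap K 3 n} (c : Fin n → K)
    (q : PolyMap K 3 n) (hf : ∀ i, f i = C (c i) * X 0 + q i)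
    (hq : ∀ i, q i ∈ supported K {0}ᶜ) : HasConstantShift (pointMap f) := by
  refine ⟨Pi.single 0 1, by simp, c, fun p t => ?_⟩
  funext i
  simp only [pointMap, hf, map_add, eval_add_smul_single (hq i), map_mul, eval_C, eval_X,
    Pi.add_apply, Pi.smul_apply, Pi.single_eq_same, smul_eq_mul]
  ring

lemma hasDirectedShift_of_supported {f : PolyMap K 3 3}
    (hf : ∀ i, i ≠ 0 → f i ∈ supported K {0}ᶜ) : HasDirectedShift (pointMap f) := by
  refine ⟨Pi.single 0 1, by simp, Pi.single 0 1, fun p t =>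
    ⟨eval (p + t • Pi.single 0 1) (f 0) - eval p (f 0), ?_⟩⟩
  funext i
  by_cases hi : i = 0
  · subst hi; simp [pointMap]
  · simp [pointMap, eval_add_smul_single (hf i hi), hi]

lemma IsTriangularAutomorphism.hasDirectedShift {f : PolyMap K 3 3}
    (hf : IsTriangularAutomorphism f) : HasDirectedShift (pointMap f) :=
  hasDirectedShift_of_supported fun i hi => supported_compl_of_notMem
    (fun h => hi (le_antisymm h (Fin.zero_le i))) (hf.2 i)

lemma starMap_eq (a r : MvPolynomial (Fin 3) K) :
    (![X 1 * X 2 + X 2 * a + X 0, X 1 + a + r, X 2] : PolyMap K 3 3) = starMap a r := by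
  rw [starMap, show X 1 * X 2 + X 2 * a + X 0 = X 0 + X 1 * X 2 + X 2 * a by ring]

lemma hasAffineShift_case2 {r₂ : MvPolynomial (Fin 3) K} (h : r₂ ∈ supported K {1, 2}) :
    HasAffineShift (pointMap (![X 0 * X 1 + X 1 * r₂ + X 2] : PolyMap K 3 1)) := by
  refine ⟨Pi.single 0 1, by simp, LinearMap.pi fun _ => LinearMap.proj 1, 0, fun p t => ?_⟩
  funext i
  have := eval_add_smul_single (supported_compl_of_notMem (i := 0) (by decide) h) p t
  fin_cases i
  simp [pointMap, this]
  ring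

lemma hasAffineShift_case5 {a₂ : MvPolynomial (Fin 3) K} (h : a₂ ∈ supported K {0, 2})
    (r₁ r₂ r₃ : K) : HasAffineShift (pointMap (![X 1 * X 2 + X 2 * a₂ + X 0,
        X 1 + a₂ + C r₁ * X 2 + C r₂ * X 2 ^ 2 + C r₃ * X 2 ^ 3] : PolyMap K 3 2)) := by
  refine ⟨Pi.single 1 1, by simp, LinearMap.single K (fun _ => K) 0 ∘ₗ LinearMap.proj 2, ![0, 1], fun p t => ?_⟩
  have := eval_add_smul_single (supported_compl_of_notMem (i := 1) (by decide) h) p t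
  funext i
  fin_cases i <;> simp [pointMap, this, Matrix.vecHead, Matrix.vecTail] <;> ring

lemma hasAffineShift_case6 {a₂ : MvPolynomial (Fin 3) K} (h : a₂ ∈ supported K {0, 2}) :
    HasAffineShift (pointMap (![X 1 * X 2 + X 2 * a₂ + X 0, X 2] : PolyMap K 3 2)) := by
  refine ⟨Pi.single 1 1, by simp, LinearMap.single K (fun _ => K) 0 ∘ₗ LinearMap.proj 2, 0, fun p t => ?_⟩
  have := eval_add_smul_single (supported_compl_of_notMem (i := 1) (by decide) h) p t
  funext i
  fin_cases i
  · simp [pointMap, this]; ring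
  · simp [pointMap]

lemma hasAffineFunctional_of_eq_X {f : PolyMap K 3 2} {j : Fin 3} (hf : f 1 = X j) :
    HasAffineFunctional (pointMap f) := by
  refine ⟨LinearMap.proj 1, fun h => ?_, LinearMap.proj j, 0, fun p => by simp [pointMap, hf]⟩
  simpa using LinearMap.congr_fun h (Pi.single 1 1)

variable [Infinite K]

/-- No translation changes `x y + y (α z² + β z y + γ y²) + z` by a constant, linearly in its
length. -/
lemma shift_eq_zero_of_constant {α β γ : K} (h0 : ¬ (α = 0 ∧ β = 0)) {u v w c : K}
    (h : ∀ x y z t : K, (x + t * u) * (y + t * v) + (y + t * v) * (α * (z + t * w) ^ 2 +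
        β * ((z + t * w) * (y + t * v)) + γ * (y + t * v) ^ 2) + (z + t * w) =
      x * y + y * (α * z ^ 2 + β * (z * y) + γ * y ^ 2) + z + t * c) :
    u = 0 ∧ v = 0 ∧ w = 0 := by
  have hv : v = 0 := by linear_combination h 1 0 0 1 - h 0 0 0 1
  subst hv
  have h1 : ∀ y z : K, w - c + u * y + β * w * y ^ 2 + 2 * α * w * y * z = 0 ∧
      α * w ^ 2 * y = 0 := fun y z => by
    have := cubic_coeffs_eq_zero (a := 0)
      (b := w - c + u * y + β * w * y ^ 2 + 2 * α * w * y * z) (c := α * w ^ 2 * y) (d := 0)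
      fun t => by linear_combination h 0 y z t
    exact ⟨this.2.1, this.2.2.1⟩
  have h2 := cubic_coeffs_eq_zero (a := w - c) (b := u) (c := β * w) (d := 0)
    fun y => by linear_combination (h1 y 0).1
  have h3 := (h1 1 0).2
  refine ⟨h2.2.1, rfl, ?_⟩
  by_contra hw
  refine h0 ⟨by simpa [hw] using h3, by simpa [hw] using h2.2.2.1⟩

/-- No translation changes `x y² + y (z² + a z + b) + z` by an affine function, linearly in its
length. -/
lemma shift_eq_zero_of_affine {a b u v w l₀ l₁ l₂ c : K}
    (h : ∀ x y z t : K, (x + t * u) * (y + t * v) ^ 2 + (y + t * v) * ((z + t * w) ^ 2 +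
        a * (z + t * w) + b) + (z + t * w) =
      x * y ^ 2 + y * (z ^ 2 + a * z + b) + z + t * (l₀ * x + l₁ * y + l₂ * z + c)) :
    u = 0 ∧ v = 0 ∧ w = 0 := by
  have h1 : ∀ x y : K, x * v ^ 2 + 2 * u * v * y + y * w ^ 2 + v * w * a = 0 := fun x y =>
    (cubic_coeffs_eq_zero (a := 0) (b := 2 * x * y * v + u * y ^ 2 + y * a * w + v * b + w -
        (l₀ * x + l₁ * y + c)) (c := x * v ^ 2 + 2 * u * v * y + y * w ^ 2 + v * w * a)
      (d := u * v ^ 2 + v * w ^ 2) fun t => by linear_combination h x y 0 t).2.2.1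
  have hv : v = 0 := by
    have : v ^ 2 = 0 := by linear_combination h1 1 0 - h1 0 0
    simpa using this
  subst hv
  have hw : w = 0 := by
    have : w ^ 2 = 0 := by linear_combination h1 0 1
    simpa using this
  subst hw
  have hu := cubic_coeffs_eq_zero (a := -c) (b := -l₁) (c := u) (d := 0)
    fun y => by linear_combination h 0 y 0 1
  exact ⟨hu.2.2.1, rfl, rfl⟩

lemma not_hasDirectedShift_starMap {a r : MvPolynomial (Fin 3) K} (ha : a ∈ supported K {0, 2})
    (ha' : a ∉ supported K {2}) (ha₂ : a.IsHomogeneous 2) (hr : r ∈ supported K {2}) :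
    ¬ HasDirectedShift (pointMap (starMap a r)) := by
  obtain ⟨α, β, γ, h0, rfl⟩ := exists_quadratic_form_of_notMem (by decide) ha ha' ha₂
  rintro ⟨v, hv, w, h⟩
  have h' : ∀ x y z t : K, ∃ s : K,
      x + t * v 0 + (y + t * v 1) * (z + t * v 2) + (z + t * v 2) * (α * (x + t * v 0) ^ 2 +
        β * ((x + t * v 0) * (z + t * v 2)) + γ * (z + t * v 2) ^ 2) =
        x + y * z + z * (α * x ^ 2 + β * (x * z) + γ * z ^ 2) + s * w 0 ∧
      y + t * v 1 + (α * (x + t * v 0) ^ 2 + β * ((x + t * v 0) * (z + t * v 2)) +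
        γ * (z + t * v 2) ^ 2) + eval ![x + t * v 0, y + t * v 1, z + t * v 2] r =
        y + (α * x ^ 2 + β * (x * z) + γ * z ^ 2) + eval ![x, y, z] r + s * w 1 ∧
      t * v 2 = s * w 2 := fun x y z t => by
    obtain ⟨s, hs⟩ := h ![x, y, z] t
    rw [vec_eq (![x, y, z] + t • v)] at hs
    have e0 := congrFun hs 0
    have e1 := congrFun hs 1
    have e2 := congrFun hs 2
    simp [pointMap, starMap] at e0 e1 e2
    exact ⟨s, e0, e1, e2⟩
  have hk : v 2 = 0 := by
    by_contra hk
    obtain ⟨s, e0, -, e2⟩ := h' 0 0 0 1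
    obtain ⟨s', e0', -, e2'⟩ := h' 0 1 0 1
    have hw : w 2 ≠ 0 := fun hw => hk (by simpa [hw] using e2)
    have hs : s = s' := mul_right_cancel₀ hw (e2.symm.trans e2')
    subst hs
    exact hk (by linear_combination e0' - e0)
  have key : ∀ x z t : K, ∃ s : K,
      t * v 0 + z * (t * v 1 + α * (2 * x * t * v 0 + t ^ 2 * v 0 ^ 2) + β * t * v 0 * z) =
        s * w 0 ∧
      t * v 1 + α * (2 * x * t * v 0 + t ^ 2 * v 0 ^ 2) + β * t * v 0 * z = s * w 1 :=
      fun x z t => by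
    obtain ⟨s, e0, e1, -⟩ := h' x 0 z t
    have hre : eval ![x + t * v 0, 0 + t * v 1, z + t * v 2] r = eval ![x, 0, z] r :=
      eval_eq_of_mem_supported hr fun i hi => by
        rw [Set.mem_singleton_iff] at hi; subst hi; simp [hk]
    rw [hre, hk] at e1
    rw [hk] at e0
    exact ⟨s, by linear_combination e0, by linear_combination e1⟩
  have hu : v 0 = 0 ∧ v 1 = 0 := by
    by_cases hw : w 1 = 0
    · have h1 : ∀ x z t : K,
          t * v 1 + α * (2 * x * t * v 0 + t ^ 2 * v 0 ^ 2) + β * t * v 0 * z = 0 :=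
        fun x z t => by
          obtain ⟨s, -, e⟩ := key x z t
          simpa [hw] using e
      have h2 := cubic_coeffs_eq_zero (a := 0) (b := v 1) (c := α * v 0 ^ 2) (d := 0)
        fun t => by linear_combination h1 0 0 t
      have h3 : β * v 0 = 0 := by linear_combination h1 0 1 1 - h1 0 0 1
      refine ⟨?_, h2.2.1⟩
      by_contra hne
      exact h0 ⟨by simpa [hne] using h2.2.2.1, by simpa [hne] using h3⟩
    · have hu : v 0 = 0 := by
        obtain ⟨s, e0, e1⟩ := key 0 (w 0 / w 1) 1
        rw [e1] at e0
        field_simp at e0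
        linear_combination e0
      have hv1 : v 1 * w 0 = 0 := by
        obtain ⟨s, e0, e1⟩ := key 0 0 1
        rw [hu] at e0 e1
        linear_combination w 0 * e1 - w 1 * e0
      have hv2 : v 1 * w 1 = 0 := by
        obtain ⟨s, e0, e1⟩ := key 0 1 1
        rw [hu] at e0 e1
        linear_combination w 1 * e0 - w 0 * e1 + hv1
      exact ⟨hu, by simpa [hw] using hv2⟩
  apply hv
  rw [vec_eq v, hu.1, hu.2, hk]
  simp

lemma not_hasConstantShift_case2 {n : ℕ} {f : PolyMap K 3 n} {r₂ : MvPolynomial (Fin 3) K}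
    (h : r₂ ∈ supported K {1, 2}) (h' : r₂ ∉ supported K {1}) (h'' : r₂.IsHomogeneous 2)
    (i : Fin n) (hf : f i = X 0 * X 1 + X 1 * r₂ + X 2) : ¬ HasConstantShift (pointMap f) := by
  rw [Set.pair_comm] at h
  obtain ⟨α, β, γ, h0, rfl⟩ := exists_quadratic_form_of_notMem (by decide) h h' h''
  intro hs
  obtain ⟨u, v, w, hne, hs⟩ := hs.exists_coords
  obtain ⟨c, hc⟩ := hs i
  rw [hf] at hc
  simp at hc
  exact hne (shift_eq_zero_of_constant h0 hc)

lemma not_hasConstantShift_case6 {n : ℕ} {f : PolyMap K 3 n} {a₂ : MvPolynomial (Fin 3) K}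
    (h : a₂ ∈ supported K {0, 2}) (h' : a₂ ∉ supported K {2}) (h'' : a₂.IsHomogeneous 2)
    (i : Fin n) (hf : f i = X 1 * X 2 + X 2 * a₂ + X 0) : ¬ HasConstantShift (pointMap f) := by
  obtain ⟨α, β, γ, h0, rfl⟩ := exists_quadratic_form_of_notMem (by decide) h h' h''
  intro hs
  obtain ⟨u, v, w, hne, hs⟩ := hs.exists_coords
  obtain ⟨c, hc⟩ := hs i
  rw [hf] at hc
  simp at hc
  obtain ⟨hv, hw, hu⟩ := shift_eq_zero_of_constant h0 fun x y z t => hc z x y t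
  exact hne ⟨hu, hv, hw⟩

lemma not_hasAffineShift_case3 {n : ℕ} {f : PolyMap K 3 n} {a b : K}
    (i : Fin n) (hf : f i = X 0 * X 1 ^ 2 + X 1 * (X 2 ^ 2 + C a * X 2 + C b) + X 2) :
    ¬ HasAffineShift (pointMap f) := by
  intro hs
  obtain ⟨u, v, w, hne, hs⟩ := hs.exists_coords
  obtain ⟨l₀, l₁, l₂, c, hc⟩ := hs i
  rw [hf] at hc
  simp at hc
  exact hne (shift_eq_zero_of_affine hc)

lemma not_hasAffineShift_case8 {n : ℕ} {f : PolyMap K 3 n} (i j : Fin n)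
    (hi : f i = X 0 + X 2 ^ 2 + X 1 ^ 3) (hj : f j = X 1 + X 0 ^ 2) :
    ¬ HasAffineShift (pointMap f) := by
  intro hs
  obtain ⟨u, v, w, hne, hs⟩ := hs.exists_coords
  obtain ⟨_, _, _, c, hc⟩ := hs i
  obtain ⟨_, _, _, d, hd⟩ := hs j
  rw [hi] at hc
  rw [hj] at hd
  simp at hc hd
  have h1 := cubic_coeffs_eq_zero (a := 0) (b := u - c) (c := w ^ 2) (d := v ^ 3)
    fun t => by linear_combination hc 0 0 0 t
  have h2 := cubic_coeffs_eq_zero (a := 0) (b := v - d) (c := u ^ 2) (d := 0)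
    fun t => by linear_combination hd 0 0 0 t
  exact hne ⟨by simpa using h2.2.2.1, by simpa using h1.2.2.2, by simpa using h1.2.2.1⟩

lemma not_hasAffineShift_case9 {n : ℕ} {f : PolyMap K 3 n} (i j : Fin n)
    (hi : f i = X 0 + X 2 ^ 2 + X 1 ^ 3) (hj : f j = X 2 + X 0 ^ 3) :
    ¬ HasAffineShift (pointMap f) := by
  intro hs
  obtain ⟨u, v, w, hne, hs⟩ := hs.exists_coords
  obtain ⟨_, _, _, c, hc⟩ := hs i
  obtain ⟨_, _, _, d, hd⟩ := hs j
  rw [hi] at hc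
  rw [hj] at hd
  simp at hc hd
  have h1 := cubic_coeffs_eq_zero (a := 0) (b := u - c) (c := w ^ 2) (d := v ^ 3)
    fun t => by linear_combination hc 0 0 0 t
  have h2 := cubic_coeffs_eq_zero (a := 0) (b := w - d) (c := 0) (d := u ^ 3)
    fun t => by linear_combination hd 0 0 0 t
  exact hne ⟨by simpa using h2.2.2.2, by simpa using h1.2.2.2, by simpa using h1.2.2.1⟩

lemma not_hasAffineFunctional_case5 {a₂ : MvPolynomial (Fin 3) K} (r₁ r₂ r₃ : K)
    (h : a₂ ∈ supported K {0, 2}) (h' : a₂ ∉ supported K {2}) (h'' : a₂.IsHomogeneous 2) :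
    ¬ HasAffineFunctional (pointMap (![X 1 * X 2 + X 2 * a₂ + X 0,
        X 1 + a₂ + C r₁ * X 2 + C r₂ * X 2 ^ 2 + C r₃ * X 2 ^ 3] : PolyMap K 3 2)) := by
  obtain ⟨α, β, γ, h0, rfl⟩ := exists_quadratic_form_of_notMem (by decide) h h' h''
  intro hs
  obtain ⟨a, b, hne, l₀, l₁, l₂, c, hs⟩ := hs.exists_coords
  simp at hs
  have ha : a = 0 := by linear_combination hs 0 1 1 - hs 0 1 0 - hs 0 0 1 + hs 0 0 0
  subst ha
  have h1 := cubic_coeffs_eq_zero (a := -c) (b := -l₀) (c := b * α) (d := 0)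
    fun x => by linear_combination hs x 0 0
  have h2 : b * β = 0 := by linear_combination hs 1 0 1 - hs 1 0 0 - hs 0 0 1 + hs 0 0 0
  refine hne ⟨rfl, ?_⟩
  by_contra hb
  exact h0 ⟨by simpa [hb] using h1.2.2.1, by simpa [hb] using h2⟩

lemma not_hasAffineFunctional_case8 :
    ¬ HasAffineFunctional
      (pointMap (![X 0 + X 2 ^ 2 + X 1 ^ 3, X 1 + X 0 ^ 2] : PolyMap K 3 2)) := by
  intro hs
  obtain ⟨a, b, hne, l₀, l₁, l₂, c, hs⟩ := hs.exists_coords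
  simp at hs
  have h1 := cubic_coeffs_eq_zero (a := -c) (b := -l₂) (c := a) (d := 0)
    fun z => by linear_combination hs 0 0 z
  have h2 := cubic_coeffs_eq_zero (a := -c) (b := a - l₀) (c := b) (d := 0)
    fun x => by linear_combination hs x 0 0
  exact hne ⟨h1.2.2.1, h2.2.2.1⟩

lemma not_hasAffineFunctional_case9 :
    ¬ HasAffineFunctional
      (pointMap (![X 0 + X 2 ^ 2 + X 1 ^ 3, X 2 + X 0 ^ 3] : PolyMap K 3 2)) := by
  intro hs
  obtain ⟨a, b, hne, l₀, l₁, l₂, c, hs⟩ := hs.exists_coords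
  simp at hs
  have h1 := cubic_coeffs_eq_zero (a := -c) (b := b - l₂) (c := a) (d := 0)
    fun z => by linear_combination hs 0 0 z
  have h2 := cubic_coeffs_eq_zero (a := -c) (b := a - l₀) (c := 0) (d := b)
    fun x => by linear_combination hs x 0 0
  exact hne ⟨h1.2.2.1, h2.2.2.2⟩

/-- The invariants of the eleven families. -/
lemma InFamily.invariants {k n : ℕ} {f : PolyMap K 3 n} (hf : InFamily k f) :
    (k = 1 ∧ n = 1 ∧ HasConstantShift (pointMap f)) ∨
    (k = 2 ∧ n = 1 ∧ HasAffineShift (pointMap f) ∧ ¬ HasConstantShift (pointMap f)) ∨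
    (k = 3 ∧ n = 1 ∧ ¬ HasAffineShift (pointMap f)) ∨
    (k = 4 ∧ n = 2 ∧ HasConstantShift (pointMap f)) ∨
    (k = 5 ∧ n = 2 ∧ HasAffineShift (pointMap f) ∧ ¬ HasConstantShift (pointMap f) ∧
      ¬ HasAffineFunctional (pointMap f)) ∨
    (k = 6 ∧ n = 2 ∧ HasAffineShift (pointMap f) ∧ ¬ HasConstantShift (pointMap f) ∧
      HasAffineFunctional (pointMap f)) ∨
    (k = 7 ∧ n = 2 ∧ ¬ HasAffineShift (pointMap f) ∧ HasAffineFunctional (pointMap f)) ∨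
    (k = 8 ∧ n = 2 ∧ ¬ HasAffineShift (pointMap f) ∧ ¬ HasAffineFunctional (pointMap f) ∧
      CharP K 2) ∨
    (k = 9 ∧ n = 2 ∧ ¬ HasAffineShift (pointMap f) ∧ ¬ HasAffineFunctional (pointMap f) ∧
      CharP K 3) ∨
    (k = 10 ∧ n = 3 ∧ HasDirectedShift (pointMap f)) ∨
    (k = 11 ∧ n = 3 ∧ ¬ HasDirectedShift (pointMap f)) := by
  have h12 : ∀ {q : MvPolynomial (Fin 3) K}, q ∈ supported K {1, 2} → q ∈ supported K {0}ᶜ :=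
    fun h => supported_compl_of_notMem (by decide) h
  have hX : ∀ i : Fin 3, i ≠ 0 → (X i : MvPolynomial (Fin 3) K) ∈ supported K {0}ᶜ :=
    fun i hi => X_mem_supported.2 hi
  have hz : ∀ (r : K) (n : ℕ), (C r * X 2 ^ n : MvPolynomial (Fin 3) K) ∈ supported K {0}ᶜ :=
    fun r n => C_mul_X_pow_mem_supported r n (by decide)
  have hy : ∀ r s : K,
      (X 1 + C r * X 2 ^ 2 + C s * X 2 ^ 3 : MvPolynomial (Fin 3) K) ∈ supported K {0}ᶜ :=
    fun r s => add_mem (add_mem (hX 1 (by decide)) (hz r 2)) (hz s 3)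
  cases hf with
  | case1 r₂ r₃ h₂ h₂' h₃ h₃' =>
    refine .inl ⟨rfl, rfl, hasConstantShift_of_supported ![1] ![r₂ + r₃] (fun i => ?_)
      fun i => ?_⟩
    · fin_cases i
      simp [add_assoc]
    · fin_cases i
      exact add_mem (h12 h₂) (h12 h₃)
  | case2 r₂ h h' h'' =>
    exact .inr <| .inl ⟨rfl, rfl, hasAffineShift_case2 h,
      not_hasConstantShift_case2 h h' h'' 0 rfl⟩
  | case3 a b => exact .inr <| .inr <| .inl ⟨rfl, rfl, not_hasAffineShift_case3 0 rfl⟩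
  | case4 p₂ p₃ q₂ q₃ h₂ h₂' h₃ h₃' =>
    refine .inr <| .inr <| .inr <| .inl ⟨rfl, rfl, hasConstantShift_of_supported ![1, 0]
      ![p₂ + p₃, X 1 + C q₂ * X 2 ^ 2 + C q₃ * X 2 ^ 3] (fun i => ?_) fun i => ?_⟩
    · fin_cases i <;> simp [add_assoc]
    · fin_cases i
      · exact add_mem (h12 h₂) (h12 h₃)
      · exact hy q₂ q₃
  | case5 a₂ r₁ r₂ r₃ h h' h'' =>
    exact .inr <| .inr <| .inr <| .inr <| .inl ⟨rfl, rfl, hasAffineShift_case5 h r₁ r₂ r₃,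
      not_hasConstantShift_case6 h h' h'' 0 rfl, not_hasAffineFunctional_case5 r₁ r₂ r₃ h h' h''⟩
  | case6 a₂ h h' h'' =>
    exact .inr <| .inr <| .inr <| .inr <| .inr <| .inl ⟨rfl, rfl, hasAffineShift_case6 h,
      not_hasConstantShift_case6 h h' h'' 0 rfl, hasAffineFunctional_of_eq_X rfl⟩
  | case7 a b =>
    exact .inr <| .inr <| .inr <| .inr <| .inr <| .inr <| .inl ⟨rfl, rfl,
      not_hasAffineShift_case3 0 rfl, hasAffineFunctional_of_eq_X rfl⟩
  | case8 hK =>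
    exact .inr <| .inr <| .inr <| .inr <| .inr <| .inr <| .inr <| .inl ⟨rfl, rfl,
      not_hasAffineShift_case8 0 1 rfl rfl, not_hasAffineFunctional_case8, hK⟩
  | case9 hK =>
    exact .inr <| .inr <| .inr <| .inr <| .inr <| .inr <| .inr <| .inr <| .inl ⟨rfl, rfl,
      not_hasAffineShift_case9 0 1 rfl rfl, not_hasAffineFunctional_case9, hK⟩
  | case10 p₂ p₃ q₂ q₃ h₂ h₂' h₃ h₃' =>
    refine .inr <| .inr <| .inr <| .inr <| .inr <| .inr <| .inr <| .inr <| .inr <| .inl ⟨rfl, rfl,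
      hasDirectedShift_of_supported fun i hi => ?_⟩
    fin_cases i
    · exact absurd rfl hi
    · exact hy q₂ q₃
    · exact hX 2 (by decide)
  | case11 a₂ r₂ r₃ h h' h'' =>
    refine .inr <| .inr <| .inr <| .inr <| .inr <| .inr <| .inr <| .inr <| .inr <| .inr ⟨rfl, rfl,
      ?_⟩
    rw [add_assoc (X 1 + a₂), starMap_eq]
    exact not_hasDirectedShift_starMap h h' h'' (add_mem
      (C_mul_X_pow_mem_supported r₂ 2 rfl) (C_mul_X_pow_mem_supported r₃ 3 rfl))

lemma InFamily.eq_of_affineEquivalent {k l n : ℕ} {f g : PolyMap K 3 n} (hf : InFamily k f)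
    (hg : InFamily l g) (h : AffineEquivalent f g) : k = l := by
  have hc := h.affineConj
  have hT : HasConstantShift (pointMap f) ↔ HasConstantShift (pointMap g) :=
    ⟨.of_conj hc.symm, .of_conj hc⟩
  have hB : HasAffineShift (pointMap f) ↔ HasAffineShift (pointMap g) :=
    ⟨.of_conj hc.symm, .of_conj hc⟩
  have hL : HasAffineFunctional (pointMap f) ↔ HasAffineFunctional (pointMap g) :=
    ⟨.of_conj hc.symm, .of_conj hc⟩
  have hD : HasDirectedShift (pointMap f) ↔ HasDirectedShift (pointMap g) :=
    ⟨.of_conj hc.symm, .of_conj hc⟩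
  have hTB := HasConstantShift.hasAffineShift (F := pointMap g)
  have hchar : ¬ (CharP K 2 ∧ CharP K 3) := fun ⟨h₂, h₃⟩ => by
    have := CharP.eq K h₂ h₃
    omega
  have h₁ := hf.invariants
  have h₂ := hg.invariants
  rw [hT, hB, hL, hD] at h₁
  clear hT hB hL hD
  generalize HasConstantShift (pointMap g) = T at *
  generalize HasAffineShift (pointMap g) = B at *
  generalize HasAffineFunctional (pointMap g) = L at *
  generalize HasDirectedShift (pointMap g) = D at *
  generalize CharP K 2 = c₂ at *
  generalize CharP K 3 = c₃ at *
  clear hc h hf hg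
  grind (splits := 40)

end Families

end PolyMap

theorem mainTheorem5 {K : Type*} [Field K] [IsAlgClosed K] :
    (∀ (k n : ℕ) (f : PolyMap K 3 n),
      PolyMap.InFamily k f → PolyMap.IsAffineLinearSystemOfAffineSpaces f) ∧
    (∀ (k l n : ℕ) (f g : PolyMap K 3 n),
      PolyMap.InFamily k f → PolyMap.InFamily l g → PolyMap.AffineEquivalent f g → k = l) ∧
    (∀ a r : MvPolynomial (Fin 3) K,
      a ∈ MvPolynomial.supported K {0, 2} → a ∉ MvPolynomial.supported K {2} →
      a.IsHomogeneous 2 →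
      r ∈ MvPolynomial.supported K {2} → r.totalDegree ≤ 3 →
      PolyMap.IsAutomorphism (PolyMap.starMap a r) ∧
      ∀ t : PolyMap K 3 3, PolyMap.IsTriangularAutomorphism t →
        ¬ PolyMap.AffineEquivalent (PolyMap.starMap a r) t) := by
  have : Infinite K := IsAlgClosed.instInfinite
  refine ⟨fun k n f hf => PolyMap.isAffineLinearSystem_of_inFamily hf,
    fun k l n f g hf hg h => hf.eq_of_affineEquivalent hg h,
    fun a r ha ha' ha₂ hr _ => ⟨PolyMap.isAutomorphism_starMap ha hr, fun t ht h => ?_⟩⟩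
  exact PolyMap.not_hasDirectedShift_starMap ha ha' ha₂ hr
    (ht.hasDirectedShift.of_conj h.affineConj)
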